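/- Let $m_1,m_2,r_1,r_2,g>0$ be real numbers such that $$\frac{m_1}{m_2}\neq\frac{r_1(r_1+r_2)}{r_2^2-r_1(r_1+r_2)},\qquad \frac{m_1}{m_2}\neq\frac{r_1(r_1-r_2)}{r_2^2-r_1(r_1-r_2)},\qquad \frac{m_1}{m_2}\neq\frac{r_2^2-r_1^2}{r_1^2},$$ where a condition whose right-hand side has denominator zero is void. Consider the double inverted pendulum on a cart with states $z=(\theta_1,\theta_2,\omega_1,\omega_2)\in\mathbb R^4$ (angles represented by real numbers). Put $\delta=\theta_1-\theta_2$, $\Delta=r_1r_2\,(m_1+m_2\sin^2\delta)>0$, $$f(z)=\frac1{\Delta}\begin{pmatrix}\omega_1\Delta\\ \omega_2\Delta\\ -g\,r_2\,[m_2\sin\theta_2\cos\delta-(m_1+m_2)\sin\theta_1]\\ -g\,r_1(m_1+m_2)[\cos\delta\,\sin\theta_1-\sin\theta_2]\end{pmatrix}+\frac{\sin\delta}{\Delta}\begin{pmatrix}0\\0\\-m_2r_2\,[r_1\cos\delta\;\omega_1^2+r_2\,\omega_2^2]\\ r_1\,[r_1(m_1+m_2)\,\omega_1^2+r_2m_2\cos\delta\;\omega_2^2]\end{pmatrix},$$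 $$h(z)=\frac{m_2}{\Delta}\begin{pmatrix}0\\0\\ r_2\,[r_1m_2\cos\delta-r_2m_1]\\ r_1\,[r_2m_1\cos\delta-r_1(m_1+m_2)]\end{pmatrix},$$ and let $\mathcal F=\{X_1,X_2,X_3,X_4\}$ be the family of vector fields $X_1=\Delta f$, $X_2=\Delta h$, $X_3=[X_1,X_2]$, $X_4=[X_2,X_3]$ on $\mathbb R^4$. Let $H=T+U$ be the total energy (the Hamiltonian in the variables $(\theta,\omega)$), where $$T=\tfrac12(m_1+m_2)r_1^2\omega_1^2+m_2r_1r_2\,\omega_1\omega_2\cos\delta+\tfrac12m_2r_2^2\omega_2^2,\qquad U=g\,[(m_1+m_2)r_1\cos\theta_1+m_2r_2\cos\theta_2],$$ and for an open set $C\subseteq\mathbb R$ of energy values let $M=\{z: H(z)\in C\}$, an open subset of $\mathbb R^4$ (the whole state space if $C=\mathbb R$). Then $\mathcal F$ is bracket-generating on $M$: for every $p\in M$, $$\mathrm{Lie}_p(\mathcal F)=T_pM=\mathbb R^4,$$ where $\mathrm{Lie}(\mathcal F)$ is the real linear span of all iterated brackets $[Y_1,[Y_2,[\dots[Y_{k-1},Y_k]\dots]]]$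 with $k\ge1$ and $Y_1,\dots,Y_k\in\mathcal F$, and $\mathrm{Lie}_p(\mathcal F)=\{Y(p):Y\in\mathrm{Lie}(\mathcal F)\}$. -/

import Mathlib

/-- State space of the double pendulum on a cart, in the coordinates
`z = (θ₁, θ₂, ω₁, ω₂)` (indices `0, 1, 2, 3`), the angles being represented by real numbers. -/
abbrev PIDPState : Type := Fin 4 → ℝ

/-- Parameters: masses `m₁, m₂`, lengths `r₁, r₂`, gravitational acceleration `g`. -/
structure PIDPParams where
  m₁ : ℝ
  m₂ : ℝ
  r₁ : ℝ
  r₂ : ℝ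
  g : ℝ

namespace PIDPParams

open Real

/-- The five physical parameters are positive. -/
def Positive (P : PIDPParams) : Prop :=
  0 < P.m₁ ∧ 0 < P.m₂ ∧ 0 < P.r₁ ∧ 0 < P.r₂ ∧ 0 < P.g

/-- The standing assumption on the parameters. (Where a denominator on the right is zero, the
corresponding condition is void: Lean's quotient is then `0`, and `m₁ / m₂ > 0`.) -/
def Nondegenerate (P : PIDPParams) : Prop :=
  P.m₁ / P.m₂ ≠ P.r₁ * (P.r₁ + P.r₂) / (P.r₂ ^ 2 - P.r₁ * (P.r₁ + P.r₂)) ∧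
  P.m₁ / P.m₂ ≠ P.r₁ * (P.r₁ - P.r₂) / (P.r₂ ^ 2 - P.r₁ * (P.r₁ - P.r₂)) ∧
  P.m₁ / P.m₂ ≠ (P.r₂ ^ 2 - P.r₁ ^ 2) / P.r₁ ^ 2

/-- Kinetic energy `T(θ, ω)`. -/
noncomputable def kinetic (P : PIDPParams) (z : PIDPState) : ℝ :=
  1 / 2 * (P.m₁ + P.m₂) * P.r₁ ^ 2 * z 2 ^ 2
    + P.m₂ * P.r₁ * P.r₂ * z 2 * z 3 * cos (z 0 - z 1)
    + 1 / 2 * P.m₂ * P.r₂ ^ 2 * z 3 ^ 2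

/-- Potential energy `U(θ)`. -/
noncomputable def potential (P : PIDPParams) (z : PIDPState) : ℝ :=
  P.g * ((P.m₁ + P.m₂) * P.r₁ * cos (z 0) + P.m₂ * P.r₂ * cos (z 1))

/-- The Lagrangian `L = T - U`. -/
noncomputable def lagrangian (P : PIDPParams) (z : PIDPState) : ℝ :=
  P.kinetic z - P.potential z

/-- The Hamiltonian `H = p₁ ω₁ + p₂ ω₂ - L`, with momenta `pᵢ = ∂L/∂ωᵢ`, as a function of the
state `(θ, ω)`, that is, pulled back along the Legendre map `(θ, ω) ↦ (θ, p)`. -/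
noncomputable def energy (P : PIDPParams) (z : PIDPState) : ℝ :=
  deriv (fun s => P.lagrangian (Function.update z 2 s)) (z 2) * z 2
    + deriv (fun s => P.lagrangian (Function.update z 3 s)) (z 3) * z 3
    - P.lagrangian z

/-- The Hamiltonian is the total energy. -/
theorem energy_eq (P : PIDPParams) (z : PIDPState) :
    P.energy z = P.kinetic z + P.potential z := by
  have h2 : HasDerivAt (fun s => P.lagrangian (Function.update z 2 s))
      ((P.m₁ + P.m₂) * P.r₁ ^ 2 * z 2 + P.m₂ * P.r₁ * P.r₂ * z 3 * cos (z 0 - z 1)) (z 2) := by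
    have e : (fun s => P.lagrangian (Function.update z 2 s)) = fun s : ℝ =>
        1 / 2 * (P.m₁ + P.m₂) * P.r₁ ^ 2 * s ^ 2
          + s * (P.m₂ * P.r₁ * P.r₂ * z 3 * cos (z 0 - z 1))
          + (1 / 2 * P.m₂ * P.r₂ ^ 2 * z 3 ^ 2 - P.potential z) := by
      funext s
      simp [lagrangian, kinetic, potential, Function.update]
      ring
    rw [e]
    have := (((hasDerivAt_pow 2 (z 2)).const_mul (1 / 2 * (P.m₁ + P.m₂) * P.r₁ ^ 2)).add
      ((hasDerivAt_id (z 2)).mul_const (P.m₂ * P.r₁ * P.r₂ * z 3 * cos (z 0 - z 1)))).add_const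
      (1 / 2 * P.m₂ * P.r₂ ^ 2 * z 3 ^ 2 - P.potential z)
    refine this.congr_deriv ?_
    norm_num
    ring
  have h3 : HasDerivAt (fun s => P.lagrangian (Function.update z 3 s))
      (P.m₂ * P.r₂ ^ 2 * z 3 + P.m₂ * P.r₁ * P.r₂ * z 2 * cos (z 0 - z 1)) (z 3) := by
    have e : (fun s => P.lagrangian (Function.update z 3 s)) = fun s : ℝ =>
        1 / 2 * P.m₂ * P.r₂ ^ 2 * s ^ 2
          + s * (P.m₂ * P.r₁ * P.r₂ * z 2 * cos (z 0 - z 1))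
          + (1 / 2 * (P.m₁ + P.m₂) * P.r₁ ^ 2 * z 2 ^ 2 - P.potential z) := by
      funext s
      simp [lagrangian, kinetic, potential, Function.update]
      ring
    rw [e]
    have := (((hasDerivAt_pow 2 (z 3)).const_mul (1 / 2 * P.m₂ * P.r₂ ^ 2)).add
      ((hasDerivAt_id (z 3)).mul_const (P.m₂ * P.r₁ * P.r₂ * z 2 * cos (z 0 - z 1)))).add_const
      (1 / 2 * (P.m₁ + P.m₂) * P.r₁ ^ 2 * z 2 ^ 2 - P.potential z)
    refine this.congr_deriv ?_
    norm_num
    ring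
  rw [energy, h2.deriv, h3.deriv, lagrangian, kinetic]
  ring

/-- The part `M` of the state space in which the energy takes its values in `C`. It is invariant
under the uncontrolled dynamics. -/
def energyRegion (P : PIDPParams) (C : Set ℝ) : Set PIDPState :=
  {z | P.energy z ∈ C}

/-- For open `C`, the region `M` is an open subset of the four-dimensional state space, hence
its tangent space at every point is the whole of `ℝ⁴`. -/
theorem isOpen_energyRegion (P : PIDPParams) {C : Set ℝ} (hC : IsOpen C) :
    IsOpen (P.energyRegion C) := by
  have h : Continuous P.energy := by
    rw [show P.energy = fun z => P.kinetic z + P.potential z from funext P.energy_eq]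
    unfold kinetic potential
    fun_prop
  exact hC.preimage h

/-- `Δ(θ) = r₁ r₂ [m₁ + m₂ sin² (θ₁ - θ₂)]`. -/
noncomputable def Delta (P : PIDPParams) (z : PIDPState) : ℝ :=
  P.r₁ * P.r₂ * (P.m₁ + P.m₂ * sin (z 0 - z 1) ^ 2)

/-- The drift vector field `f`. -/
noncomputable def f (P : PIDPParams) (z : PIDPState) : PIDPState :=
  (1 / P.Delta z) • ![
      z 2 * P.Delta z,
      z 3 * P.Delta z,
      -P.g * P.r₂ * (P.m₂ * sin (z 1) * cos (z 0 - z 1) - (P.m₁ + P.m₂) * sin (z 0)),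
      -P.g * P.r₁ * (P.m₁ + P.m₂) * (cos (z 0 - z 1) * sin (z 0) - sin (z 1))]
  + (sin (z 0 - z 1) / P.Delta z) • ![
      0,
      0,
      -P.m₂ * P.r₂ * (P.r₁ * cos (z 0 - z 1) * z 2 ^ 2 + P.r₂ * z 3 ^ 2),
      P.r₁ * (P.r₁ * (P.m₁ + P.m₂) * z 2 ^ 2 + P.r₂ * P.m₂ * cos (z 0 - z 1) * z 3 ^ 2)]

/-- The control vector field `h`. -/
noncomputable def h (P : PIDPParams) (z : PIDPState) : PIDPState :=
  (P.m₂ / P.Delta z) • ![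
      0,
      0,
      P.r₂ * (P.r₁ * P.m₂ * cos (z 0 - z 1) - P.r₂ * P.m₁),
      P.r₁ * (P.r₂ * P.m₁ * cos (z 0 - z 1) - P.r₁ * (P.m₁ + P.m₂))]

/-- `X₁ = Δ f`. -/
noncomputable def X₁ (P : PIDPParams) : PIDPState → PIDPState := fun z => P.Delta z • P.f z

/-- `X₂ = Δ h`. -/
noncomputable def X₂ (P : PIDPParams) : PIDPState → PIDPState := fun z => P.Delta z • P.h z

/-- `X₃ = [X₁, X₂]`. -/
noncomputable def X₃ (P : PIDPParams) : PIDPState → PIDPState :=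
  VectorField.lieBracket ℝ P.X₁ P.X₂

/-- `X₄ = [X₂, X₃]`. -/
noncomputable def X₄ (P : PIDPParams) : PIDPState → PIDPState :=
  VectorField.lieBracket ℝ P.X₂ P.X₃

/-- The family `F = {X₁, X₂, X₃, X₄}`. -/
def family (P : PIDPParams) : Set (PIDPState → PIDPState) :=
  {P.X₁, P.X₂, P.X₃, P.X₄}

end PIDPParams

/-- `Y` is an iterated bracket `[Y₁, [Y₂, [… [Yₖ₋₁, Yₖ] …]]]`, `k ≥ 1`, of members of `F`. -/
inductive IsIteratedBracket {E : Type*} [NormedAddCommGroup E] [NormedSpace ℝ E]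
    (F : Set (E → E)) : (E → E) → Prop
  | mem (X : E → E) (hX : X ∈ F) : IsIteratedBracket F X
  | bracket (X Y : E → E) (hX : X ∈ F) (hY : IsIteratedBracket F Y) :
      IsIteratedBracket F (VectorField.lieBracket ℝ X Y)

/-- `Lie(F)`: the real span of all iterated brackets of members of `F`. -/
def lieSpan {E : Type*} [NormedAddCommGroup E] [NormedSpace ℝ E]
    (F : Set (E → E)) : Submodule ℝ (E → E) :=
  Submodule.span ℝ {Y | IsIteratedBracket F Y}

/-- `Lie_p(F)`: the values at `p` of the members of `Lie(F)`. -/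
def lieSpanAt {E : Type*} [NormedAddCommGroup E] [NormedSpace ℝ E]
    (F : Set (E → E)) (p : E) : Submodule ℝ E :=
  (lieSpan F).map (LinearMap.proj p : (E → E) →ₗ[ℝ] E)

/-- `F` is bracket-generating on the open set `M`: `Lie_p(F) = T_p M` for every `p ∈ M`, where
`T_p M` is the whole space because `M` is open. -/
def IsBracketGeneratingOn {E : Type*} [NormedAddCommGroup E] [NormedSpace ℝ E]
    (F : Set (E → E)) (M : Set E) : Prop :=
  ∀ p ∈ M, lieSpanAt F p = ⊤

/-!
The iterated brackets of the family `F` generate a module over the smooth functions on `ℝ⁴`. The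
functions that multiply every vector field into this module form an ideal, `bracketIdeal F`, and
the Leibniz rule `[U, φ W] = U(φ) W + φ [U, W]` shows that the ideal is stable under the
derivations along the members of `F`. If the brackets do not span at `p`, then it consists of
functions vanishing at `p`. In characteristic zero the largest differential ideal inside a prime
ideal is again prime (`differentialCore_isPrime`), so `bracketIdeal F` lies in a *prime*
differential ideal `Q` of functions vanishing at `p` (`exists_isPrime_of_lieSpanAt_ne_top`). This
plays the role of the statement that an analytic determinant which vanishes to infinite order
along the orbit of `p` vanishes on the whole orbit.

For the pendulum, write `δ = θ₁ - θ₂` and `X₂ = m₂ (0, 0, u, v)`, where `u` and `v` depend on `δ`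
only. Both `X₂` and `X₄` are vertical (they have no `θ`-components), while `X₃ = [X₁, X₂]` and
`[X₁, X₄]` have the horizontal parts `-Δ X₂` and `-Δ X₄`. So the square of the determinant of `X₂`
and `X₄`, times `Δ`, lies in `bracketIdeal F` (`vertDet_sq_mul_deltaFun_mem`), and the determinant
equals `sin δ * (m₁ + m₂ sin² δ) * u * v` up to a positive constant (`vertDet_eq`). Since `Q` is
prime, it contains `sin δ`, `u` or `v`. As `u` and `v` have no common zero
(`not_ctrl_eq_zero`), differentiating along `X₃`, which moves `δ` at the speed `-m₂ Δ (u - v)`,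
excludes `u` and `v`. With `sin δ` in `Q`, differentiating twice along `X₁` puts first `ω₁ - ω₂`
and then, because gravity acts differently on the two angles, `sin θ₁` into `Q`. One more
derivative along `X₃` gives `cos θ₁`, and `sin θ₁` and `cos θ₁` cannot both vanish at `p`.
-/

/-! ### Differential ideals -/

section DifferentialIdeal

variable {K A : Type*} [Field K] [CommRing A] [Algebra K A]

/-- The ideal `I` is stable under every derivation in the set `𝒟`. -/
def IsDifferentialIdeal (𝒟 : Set (Derivation K A A)) (I : Ideal A) : Prop :=
  ∀ D ∈ 𝒟, ∀ a ∈ I, D a ∈ I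

/-- The largest `𝒟`-stable ideal contained in `m`. -/
def differentialCore (𝒟 : Set (Derivation K A A)) (m : Ideal A) : Ideal A :=
  sSup {I | I ≤ m ∧ IsDifferentialIdeal 𝒟 I}

variable {𝒟 : Set (Derivation K A A)} {m : Ideal A}

theorem differentialCore_le : differentialCore 𝒟 m ≤ m :=
  sSup_le fun _ hI => hI.1

theorem le_differentialCore {I : Ideal A} (hI : I ≤ m) (hD : IsDifferentialIdeal 𝒟 I) :
    I ≤ differentialCore 𝒟 m :=
  le_sSup ⟨hI, hD⟩

theorem isDifferentialIdeal_differentialCore :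
    IsDifferentialIdeal 𝒟 (differentialCore 𝒟 m) := by
  intro D hD a ha
  unfold differentialCore at ha
  rw [sSup_eq_iSup'] at ha
  refine Submodule.iSup_induction _ (motive := fun a => D a ∈ differentialCore 𝒟 m) ha ?_ ?_ ?_
  · rintro ⟨I, hI⟩ x hx
    exact le_differentialCore hI.1 hI.2 (hI.2 D hD x hx)
  · simp
  · intro x y hx hy
    rw [map_add]
    exact add_mem hx hy

/-- In characteristic zero the radical of a differential ideal is differential: differentiating
`a ^ (k + 1) * (D a) ^ j` and multiplying by `D a` trades one factor `a` for two factors `D a`. -/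
theorem IsDifferentialIdeal.radical [CharZero K] {I : Ideal A} (hI : IsDifferentialIdeal 𝒟 I) :
    IsDifferentialIdeal 𝒟 I.radical := by
  rintro D hD a ⟨n, hn⟩
  have key : ∀ k j : ℕ, a ^ k * D a ^ j ∈ I → D a ∈ I.radical := by
    intro k
    induction k with
    | zero => exact fun j hj => ⟨j, by simpa using hj⟩
    | succ k ih =>
      intro j hj
      refine ih (j + 2) ?_
      have h1 : D (a ^ (k + 1) * D a ^ j) * D a - (j : A) * D (D a) * (a ^ (k + 1) * D a ^ j) ∈ I :=
        sub_mem (I.mul_mem_right _ (hI D hD _ hj)) (I.mul_mem_left _ hj)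
      have h2 : D (a ^ (k + 1) * D a ^ j) * D a - (j : A) * D (D a) * (a ^ (k + 1) * D a ^ j)
          = ((k + 1 : ℕ) : A) * (a ^ k * D a ^ (j + 2)) := by
        rcases j with _ | j
        · simp [Derivation.leibniz_pow]
          ring
        · simp [Derivation.leibniz_pow]
          ring
      rw [h2] at h1
      have h3 := I.mul_mem_left (algebraMap K A ((k + 1 : ℕ) : K)⁻¹) h1
      rwa [← mul_assoc, ← map_natCast (algebraMap K A), ← map_mul,
        inv_mul_cancel₀ (Nat.cast_ne_zero.2 k.succ_ne_zero), map_one, one_mul] at h3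
  exact key n 0 (by simpa using hn)

/-- For a radical differential ideal, the colon ideal `{b | a * b ∈ I}` is differential. -/
theorem IsDifferentialIdeal.mul_apply_mem {I : Ideal A} (hI : IsDifferentialIdeal 𝒟 I)
    (hr : I.IsRadical) {D : Derivation K A A} (hD : D ∈ 𝒟) {a b : A} (h : a * b ∈ I) :
    a * D b ∈ I := by
  refine hr ⟨2, ?_⟩
  have h1 : D (a * b) * (a * D b) - D a * D b * (a * b) ∈ I :=
    sub_mem (I.mul_mem_right _ (hI D hD _ h)) (I.mul_mem_left _ h)
  have h2 : (a * D b) ^ 2 = D (a * b) * (a * D b) - D a * D b * (a * b) := by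
    simp only [Derivation.leibniz, smul_eq_mul]
    ring
  rwa [h2]

/-- Over a field of characteristic zero, the largest differential ideal inside a prime ideal is
prime, because its colon ideals are differential and hence obey the same maximality. -/
theorem differentialCore_isPrime [CharZero K] (hm : m.IsPrime) :
    (differentialCore 𝒟 m).IsPrime := by
  set Q := differentialCore 𝒟 m
  have hQ : IsDifferentialIdeal 𝒟 Q := isDifferentialIdeal_differentialCore
  have hrad : Q.IsRadical :=
    le_differentialCore (hm.radical_le_iff.2 differentialCore_le) hQ.radical
  have hcolon : ∀ a : A, ∀ b, a * b ∈ Q → (∀ y, a * y ∈ Q → y ∈ m) → b ∈ Q := by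
    intro a b hab hle
    let J : Ideal A := Submodule.comap (LinearMap.mulLeft A a) Q
    have hJ : IsDifferentialIdeal 𝒟 J := fun D hD x hx => hQ.mul_apply_mem hrad hD hx
    exact le_differentialCore (I := J) (fun y hy => hle y hy) hJ hab
  refine ⟨fun h => hm.ne_top (top_le_iff.1 (h ▸ differentialCore_le)), fun {a b} hab => ?_⟩
  by_cases h : ∀ y, a * y ∈ Q → y ∈ m
  · exact Or.inr (hcolon a b hab h)
  -- Otherwise some `x ∉ m` satisfies `x * a ∈ Q`, and `m` being prime, `(Q : x) ≤ m`.
  · push Not at h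
    obtain ⟨x, hx, hxm⟩ := h
    rw [mul_comm] at hx
    exact Or.inl (hcolon x a hx fun y hy =>
      (hm.mem_or_mem (differentialCore_le hy)).resolve_left hxm)

end DifferentialIdeal

/-! ### Smooth functions and vector fields -/

section SmoothFields

open scoped ContDiff

/-- The algebra of smooth real functions on `ℝⁿ`. -/
def smoothFun (n : ℕ) : Subalgebra ℝ ((Fin n → ℝ) → ℝ) where
  carrier := {φ | ContDiff ℝ ∞ φ}
  mul_mem' := fun {φ ψ} (ha : ContDiff ℝ ∞ φ) (hb : ContDiff ℝ ∞ ψ) => ha.mul hb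
  add_mem' := fun {φ ψ} (ha : ContDiff ℝ ∞ φ) (hb : ContDiff ℝ ∞ ψ) => ha.add hb
  algebraMap_mem' := fun k => (contDiff_const : ContDiff ℝ ∞ fun _ : Fin n → ℝ => k)

variable {n : ℕ}

theorem contDiff_smoothFun (φ : smoothFun n) : ContDiff ℝ ∞ (φ : (Fin n → ℝ) → ℝ) :=
  φ.2

theorem differentiableAt_smoothFun (φ : smoothFun n) (z : Fin n → ℝ) :
    DifferentiableAt ℝ (φ : (Fin n → ℝ) → ℝ) z :=
  ((contDiff_smoothFun φ).differentiable (by simp)).differentiableAt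

/-- The vector field on `ℝⁿ` with the given smooth components. -/
def toField (V : Fin n → smoothFun n) : (Fin n → ℝ) → (Fin n → ℝ) :=
  fun z i => (V i : (Fin n → ℝ) → ℝ) z

theorem contDiff_toField (V : Fin n → smoothFun n) : ContDiff ℝ ∞ (toField V) :=
  contDiff_pi.2 fun i => contDiff_smoothFun (V i)

/-- The derivative of smooth functions along the vector field with components `V`. -/
noncomputable def fieldDerivation (V : Fin n → smoothFun n) :
    Derivation ℝ (smoothFun n) (smoothFun n) :=
  Derivation.mk'
    { toFun := fun φ => ⟨fun z => fderiv ℝ (φ : (Fin n → ℝ) → ℝ) z (toField V z),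
        ((contDiff_smoothFun φ).fderiv_right (m := ∞) (by simp)).clm_apply (contDiff_toField V)⟩
      map_add' := fun φ ψ => Subtype.ext <| funext fun z => by
        change fderiv ℝ ((φ : (Fin n → ℝ) → ℝ) + (ψ : (Fin n → ℝ) → ℝ)) z _
          = fderiv ℝ _ z _ + fderiv ℝ _ z _
        rw [fderiv_add (differentiableAt_smoothFun φ z) (differentiableAt_smoothFun ψ z)]
        rfl
      map_smul' := fun k φ => Subtype.ext <| funext fun z => by
        change fderiv ℝ (k • (φ : (Fin n → ℝ) → ℝ)) z _ = k • fderiv ℝ _ z _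
        rw [fderiv_const_smul (differentiableAt_smoothFun φ z)]
        rfl }
    fun φ ψ => Subtype.ext <| funext fun z => by
      change fderiv ℝ ((φ : (Fin n → ℝ) → ℝ) * (ψ : (Fin n → ℝ) → ℝ)) z _
        = (φ : (Fin n → ℝ) → ℝ) z * fderiv ℝ _ z _ + (ψ : (Fin n → ℝ) → ℝ) z * fderiv ℝ _ z _
      rw [fderiv_mul (differentiableAt_smoothFun φ z) (differentiableAt_smoothFun ψ z)]
      rfl

theorem fieldDerivation_apply (V : Fin n → smoothFun n) (φ : smoothFun n) (z : Fin n → ℝ) :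
    (fieldDerivation V φ : (Fin n → ℝ) → ℝ) z
      = fderiv ℝ (φ : (Fin n → ℝ) → ℝ) z (toField V z) :=
  rfl

/-- The Lie bracket in components: `[V, W]ᵢ = V(Wᵢ) - W(Vᵢ)`. -/
noncomputable def fieldBracket (V W : Fin n → smoothFun n) : Fin n → smoothFun n :=
  fun i => fieldDerivation V (W i) - fieldDerivation W (V i)

theorem lieBracket_toField (V W : Fin n → smoothFun n) :
    VectorField.lieBracket ℝ (toField V) (toField W) = toField (fieldBracket V W) := by
  funext z i
  have h : ∀ (U : Fin n → smoothFun n) (w : Fin n → ℝ),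
      fderiv ℝ (toField U) z w i = fderiv ℝ (U i : (Fin n → ℝ) → ℝ) z w := by
    intro U w
    rw [show toField U = fun z i => (U i : (Fin n → ℝ) → ℝ) z from rfl,
      fderiv_pi fun i => differentiableAt_smoothFun (U i) z]
    rfl
  rw [VectorField.lieBracket, Pi.sub_apply, h, h]
  rfl

theorem fieldBracket_add (U V W : Fin n → smoothFun n) :
    fieldBracket U (V + W) = fieldBracket U V + fieldBracket U W := by
  funext i
  have h : fieldDerivation (V + W) (U i)
      = fieldDerivation V (U i) + fieldDerivation W (U i) :=
    Subtype.ext <| funext fun z =>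
      (fderiv ℝ (U i : (Fin n → ℝ) → ℝ) z).map_add (toField V z) (toField W z)
  simp only [fieldBracket, Pi.add_apply, map_add, h]
  ring

theorem fieldBracket_smul (U V : Fin n → smoothFun n) (φ : smoothFun n) :
    fieldBracket U (φ • V) = fieldDerivation U φ • V + φ • fieldBracket U V := by
  funext i
  have h : fieldDerivation (φ • V) (U i) = φ * fieldDerivation V (U i) :=
    Subtype.ext <| funext fun z =>
      (fderiv ℝ (U i : (Fin n → ℝ) → ℝ) z).map_smul ((φ : (Fin n → ℝ) → ℝ) z) (toField V z)
  simp only [fieldBracket, Pi.add_apply, Pi.smul_apply, smul_eq_mul, Derivation.leibniz, h]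
  ring

/-- The `i`-th coordinate function. -/
def coordFun (i : Fin n) : smoothFun n :=
  ⟨fun z => z i, (contDiff_apply ℝ ℝ i : ContDiff ℝ ∞ fun z : Fin n → ℝ => z i)⟩

/-- The sine of a smooth function. -/
noncomputable def sinFun (φ : smoothFun n) : smoothFun n :=
  ⟨fun z => Real.sin ((φ : (Fin n → ℝ) → ℝ) z), (contDiff_smoothFun φ).sin⟩

/-- The cosine of a smooth function. -/
noncomputable def cosFun (φ : smoothFun n) : smoothFun n :=
  ⟨fun z => Real.cos ((φ : (Fin n → ℝ) → ℝ) z), (contDiff_smoothFun φ).cos⟩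

theorem fieldDerivation_coordFun (V : Fin n → smoothFun n) (i : Fin n) :
    fieldDerivation V (coordFun i) = V i := by
  refine Subtype.ext <| funext fun z => ?_
  rw [fieldDerivation_apply]
  exact congrArg (fun L : (Fin n → ℝ) →L[ℝ] ℝ => L (toField V z))
    (ContinuousLinearMap.proj (R := ℝ) (φ := fun _ : Fin n => ℝ) i).fderiv

theorem fieldDerivation_sinFun (V : Fin n → smoothFun n) (φ : smoothFun n) :
    fieldDerivation V (sinFun φ) = cosFun φ * fieldDerivation V φ := by
  refine Subtype.ext <| funext fun z => ?_
  rw [fieldDerivation_apply]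
  exact congrArg (fun L : (Fin n → ℝ) →L[ℝ] ℝ => L (toField V z))
    (differentiableAt_smoothFun φ z).hasFDerivAt.sin.fderiv

theorem fieldDerivation_cosFun (V : Fin n → smoothFun n) (φ : smoothFun n) :
    fieldDerivation V (cosFun φ) = -(sinFun φ) * fieldDerivation V φ := by
  refine Subtype.ext <| funext fun z => ?_
  rw [fieldDerivation_apply]
  exact congrArg (fun L : (Fin n → ℝ) →L[ℝ] ℝ => L (toField V z))
    (differentiableAt_smoothFun φ z).hasFDerivAt.cos.fderiv

theorem sinFun_sq_add_cosFun_sq (φ : smoothFun n) : sinFun φ ^ 2 + cosFun φ ^ 2 = 1 :=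
  Subtype.ext <| funext fun _ => Real.sin_sq_add_cos_sq _

/-- Evaluation of smooth functions at a point. -/
def evalAt (p : Fin n → ℝ) : smoothFun n →+* ℝ :=
  (Pi.evalRingHom (fun _ : Fin n → ℝ => ℝ) p).comp (smoothFun n).val.toRingHom

end SmoothFields

/-! ### The ideal of a family of vector fields -/

section BracketIdeal

variable {n : ℕ}

/-- The module, over the smooth functions, generated by the iterated brackets of `F`. -/
def bracketModule (F : Set ((Fin n → ℝ) → (Fin n → ℝ))) :
    Submodule (smoothFun n) (Fin n → smoothFun n) :=
  Submodule.span (smoothFun n) {V | IsIteratedBracket F (toField V)}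

/-- The smooth functions `φ` such that `φ • W` lies in the module generated by the iterated
brackets of `F`, for every smooth vector field `W`. -/
def bracketIdeal (F : Set ((Fin n → ℝ) → (Fin n → ℝ))) : Ideal (smoothFun n) where
  carrier := {φ | ∀ W : Fin n → smoothFun n, φ • W ∈ bracketModule F}
  add_mem' := fun ha hb W => by rw [add_smul]; exact add_mem (ha W) (hb W)
  zero_mem' := fun W => by rw [zero_smul]; exact zero_mem _
  smul_mem' := fun c φ h W => by rw [smul_assoc]; exact Submodule.smul_mem _ c (h W)

/-- The derivations along the members of `F`. -/
def derivationsOf (F : Set ((Fin n → ℝ) → (Fin n → ℝ))) :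
    Set (Derivation ℝ (smoothFun n) (smoothFun n)) :=
  fieldDerivation '' {U | toField U ∈ F}

variable {F : Set ((Fin n → ℝ) → (Fin n → ℝ))}

theorem fieldBracket_mem_bracketModule {U V : Fin n → smoothFun n} (hU : toField U ∈ F)
    (hV : V ∈ bracketModule F) : fieldBracket U V ∈ bracketModule F := by
  refine Submodule.span_induction (p := fun V _ => fieldBracket U V ∈ bracketModule F)
    ?_ ?_ ?_ ?_ hV
  · intro W hW
    refine Submodule.subset_span ?_
    change IsIteratedBracket F _
    rw [← lieBracket_toField]
    exact .bracket _ _ hU hW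
  · have h := fieldBracket_smul U 0 0
    rw [zero_smul, zero_smul, smul_zero, add_zero] at h
    rw [h]
    exact zero_mem _
  · intro V W _ _ hV hW
    rw [fieldBracket_add]
    exact add_mem hV hW
  · intro φ V hV' hV
    rw [fieldBracket_smul]
    exact add_mem (Submodule.smul_mem _ _ hV') (Submodule.smul_mem _ _ hV)

/-- From `[U, φ W] = U(φ) W + φ [U, W]`. -/
theorem isDifferentialIdeal_bracketIdeal :
    IsDifferentialIdeal (derivationsOf F) (bracketIdeal F) := by
  rintro _ ⟨U, hU, rfl⟩ φ hφ W
  have h := fieldBracket_mem_bracketModule hU (hφ W)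
  rw [fieldBracket_smul] at h
  exact (add_mem_cancel_right (hφ _)).1 h

theorem toField_apply_mem_lieSpanAt {V : Fin n → smoothFun n} (hV : V ∈ bracketModule F)
    (p : Fin n → ℝ) : toField V p ∈ lieSpanAt F p := by
  refine Submodule.span_induction (p := fun V _ => toField V p ∈ lieSpanAt F p) ?_ ?_ ?_ ?_ hV
  · intro W hW
    exact ⟨toField W, Submodule.subset_span hW, rfl⟩
  · exact zero_mem (lieSpanAt F p)
  · intro V W _ _ hV hW
    exact add_mem hV hW
  · intro φ V _ hV
    exact Submodule.smul_mem _ (evalAt p φ) hV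

theorem bracketIdeal_le_ker_evalAt {p : Fin n → ℝ} (h : lieSpanAt F p ≠ ⊤) :
    bracketIdeal F ≤ RingHom.ker (evalAt p) := by
  intro φ hφ
  by_contra hne
  rw [RingHom.mem_ker] at hne
  refine h (eq_top_iff.2 fun w _ => ?_)
  have h1 := toField_apply_mem_lieSpanAt (hφ fun i => algebraMap ℝ (smoothFun n) (w i)) p
  have h2 := Submodule.smul_mem _ (evalAt p φ)⁻¹ h1
  convert h2 using 1
  funext i
  change w i = (evalAt p φ)⁻¹ * (evalAt p φ * w i)
  rw [inv_mul_cancel_left₀ hne]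

/-- Where `F` fails to be bracket-generating, some prime ideal of functions vanishing at the point
is stable under the derivations along `F` and contains `bracketIdeal F`. -/
theorem exists_isPrime_of_lieSpanAt_ne_top {p : Fin n → ℝ} (h : lieSpanAt F p ≠ ⊤) :
    ∃ Q : Ideal (smoothFun n), Q.IsPrime ∧ Q ≤ RingHom.ker (evalAt p) ∧ bracketIdeal F ≤ Q ∧
      ∀ U, toField U ∈ F → ∀ φ ∈ Q, fieldDerivation U φ ∈ Q :=
  ⟨differentialCore (derivationsOf F) (RingHom.ker (evalAt p)),
    differentialCore_isPrime (RingHom.ker_isPrime _), differentialCore_le,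
    le_differentialCore (bracketIdeal_le_ker_evalAt h) isDifferentialIdeal_bracketIdeal,
    fun U hU => isDifferentialIdeal_differentialCore _ ⟨U, hU, rfl⟩⟩

end BracketIdeal

/-! ### The pendulum -/

namespace PIDPParams

variable (P : PIDPParams)

/-- A real number as a constant function on the state space. -/
noncomputable abbrev constFun (k : ℝ) : smoothFun 4 := algebraMap ℝ (smoothFun 4) k

/-- `sin (θ₁ - θ₂)`. -/
noncomputable def sinDiff : smoothFun 4 := sinFun (coordFun 0 - coordFun 1)

/-- `cos (θ₁ - θ₂)`. -/
noncomputable def cosDiff : smoothFun 4 := cosFun (coordFun 0 - coordFun 1)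

/-- `m₁ + m₂ sin² (θ₁ - θ₂)`, which is `Δ / (r₁ r₂)`. -/
noncomputable def massFun : smoothFun 4 :=
  constFun P.m₁ + constFun P.m₂ * sinDiff ^ 2

/-- `Δ` as a smooth function. -/
noncomputable def deltaFun : smoothFun 4 := constFun P.r₁ * constFun P.r₂ * P.massFun

/-- The third component of `X₂ / m₂`. -/
noncomputable def ctrl₁ : smoothFun 4 :=
  constFun P.r₂ * (constFun P.r₁ * constFun P.m₂ * cosDiff - constFun P.r₂ * constFun P.m₁)

/-- The fourth component of `X₂ / m₂`. -/
noncomputable def ctrl₂ : smoothFun 4 :=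
  constFun P.r₁ * (constFun P.r₂ * constFun P.m₁ * cosDiff
    - constFun P.r₁ * (constFun P.m₁ + constFun P.m₂))

/-- The third component of `X₁`. -/
noncomputable def drift₁ : smoothFun 4 :=
  -constFun P.g * constFun P.r₂ * (constFun P.m₂ * sinFun (coordFun 1) * cosDiff
      - (constFun P.m₁ + constFun P.m₂) * sinFun (coordFun 0))
    + sinDiff * (-constFun P.m₂ * constFun P.r₂ * (constFun P.r₁ * cosDiff * coordFun 2 ^ 2
      + constFun P.r₂ * coordFun 3 ^ 2))

/-- The fourth component of `X₁`. -/
noncomputable def drift₂ : smoothFun 4 :=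
  -constFun P.g * constFun P.r₁ * (constFun P.m₁ + constFun P.m₂)
      * (cosDiff * sinFun (coordFun 0) - sinFun (coordFun 1))
    + sinDiff * (constFun P.r₁ * (constFun P.r₁ * (constFun P.m₁ + constFun P.m₂) * coordFun 2 ^ 2
      + constFun P.r₂ * constFun P.m₂ * cosDiff * coordFun 3 ^ 2))

/-- The components of `X₁`. -/
noncomputable def comp₁ : Fin 4 → smoothFun 4 :=
  ![coordFun 2 * P.deltaFun, coordFun 3 * P.deltaFun, P.drift₁, P.drift₂]

/-- The components of `X₂`. -/
noncomputable def comp₂ : Fin 4 → smoothFun 4 :=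
  ![0, 0, constFun P.m₂ * P.ctrl₁, constFun P.m₂ * P.ctrl₂]

/-- The components of `X₃`. -/
noncomputable def comp₃ : Fin 4 → smoothFun 4 := fieldBracket P.comp₁ P.comp₂

/-- The components of `X₄`. -/
noncomputable def comp₄ : Fin 4 → smoothFun 4 := fieldBracket P.comp₂ P.comp₃

variable {P}

theorem Positive.Delta_pos (hpos : P.Positive) (z : PIDPState) : 0 < P.Delta z := by
  obtain ⟨h1, h2, h3, h4, -⟩ := hpos
  unfold Delta
  positivity

theorem X₁_eq (hpos : P.Positive) : P.X₁ = toField P.comp₁ := by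
  funext z i
  have h := (hpos.Delta_pos z).ne'
  have hD : P.Delta z = evalAt z P.deltaFun := rfl
  fin_cases i
  · change P.Delta z * (1 / P.Delta z * (z 2 * P.Delta z) + Real.sin (z 0 - z 1) / P.Delta z * 0)
      = z 2 * P.Delta z
    field_simp
    ring
  · change P.Delta z * (1 / P.Delta z * (z 3 * P.Delta z) + Real.sin (z 0 - z 1) / P.Delta z * 0)
      = z 3 * P.Delta z
    field_simp
    ring
  · change P.Delta z * (1 / P.Delta z * (_) + Real.sin (z 0 - z 1) / P.Delta z * (_))
      = _ + Real.sin (z 0 - z 1) * _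
    rw [mul_add, ← mul_assoc, ← mul_assoc, mul_one_div_cancel h, mul_div_cancel₀ _ h, one_mul]
    rfl
  · change P.Delta z * (1 / P.Delta z * (_) + Real.sin (z 0 - z 1) / P.Delta z * (_))
      = _ + Real.sin (z 0 - z 1) * _
    rw [mul_add, ← mul_assoc, ← mul_assoc, mul_one_div_cancel h, mul_div_cancel₀ _ h, one_mul]
    rfl

theorem X₂_eq (hpos : P.Positive) : P.X₂ = toField P.comp₂ := by
  funext z i
  have h := (hpos.Delta_pos z).ne'
  change P.Delta z * (P.m₂ / P.Delta z * _) = _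
  rw [← mul_assoc, mul_div_cancel₀ _ h]
  fin_cases i
  · exact mul_zero _
  · exact mul_zero _
  · rfl
  · rfl

theorem X₃_eq (hpos : P.Positive) : P.X₃ = toField P.comp₃ := by
  rw [X₃, X₁_eq hpos, X₂_eq hpos, lieBracket_toField, comp₃]

theorem X₄_eq (hpos : P.Positive) : P.X₄ = toField P.comp₄ := by
  rw [X₄, X₂_eq hpos, X₃_eq hpos, lieBracket_toField, comp₄]

theorem fieldDerivation_sinDiff (V : Fin 4 → smoothFun 4) :
    fieldDerivation V sinDiff = cosDiff * (V 0 - V 1) := by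
  rw [sinDiff, fieldDerivation_sinFun, map_sub, fieldDerivation_coordFun,
    fieldDerivation_coordFun, cosDiff]

theorem fieldDerivation_cosDiff (V : Fin 4 → smoothFun 4) :
    fieldDerivation V cosDiff = -sinDiff * (V 0 - V 1) := by
  rw [cosDiff, fieldDerivation_cosFun, map_sub, fieldDerivation_coordFun,
    fieldDerivation_coordFun, sinDiff]

theorem fieldDerivation_ctrl₁ (V : Fin 4 → smoothFun 4) :
    fieldDerivation V P.ctrl₁
      = -(constFun P.r₂ * constFun P.r₁ * constFun P.m₂ * sinDiff * (V 0 - V 1)) := by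
  simp only [ctrl₁, Derivation.leibniz, map_sub, Derivation.map_algebraMap, smul_eq_mul,
    fieldDerivation_cosDiff]
  ring

theorem fieldDerivation_ctrl₂ (V : Fin 4 → smoothFun 4) :
    fieldDerivation V P.ctrl₂
      = -(constFun P.r₂ * constFun P.r₁ * constFun P.m₁ * sinDiff * (V 0 - V 1)) := by
  simp only [ctrl₂, Derivation.leibniz, map_sub, map_add, Derivation.map_algebraMap, smul_eq_mul,
    fieldDerivation_cosDiff]
  ring

theorem fieldDerivation_deltaFun (V : Fin 4 → smoothFun 4) :
    fieldDerivation V P.deltaFun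
      = 2 * constFun P.r₁ * constFun P.r₂ * constFun P.m₂ * sinDiff * cosDiff * (V 0 - V 1) := by
  simp only [deltaFun, massFun, pow_two, Derivation.leibniz, map_add, Derivation.map_algebraMap,
    smul_eq_mul, fieldDerivation_sinDiff]
  ring

theorem fieldDerivation_drift₁_of_vertical {V : Fin 4 → smoothFun 4} (h0 : V 0 = 0)
    (h1 : V 1 = 0) :
    fieldDerivation V P.drift₁ = -(2 * constFun P.m₂ * constFun P.r₂ * sinDiff
      * (constFun P.r₁ * cosDiff * coordFun 2 * V 2 + constFun P.r₂ * coordFun 3 * V 3)) := by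
  simp only [drift₁, pow_two, Derivation.leibniz, map_add, map_sub, map_neg,
    Derivation.map_algebraMap, smul_eq_mul, fieldDerivation_sinDiff, fieldDerivation_cosDiff,
    fieldDerivation_sinFun, fieldDerivation_coordFun, h0, h1]
  ring

theorem fieldDerivation_drift₂_of_vertical {V : Fin 4 → smoothFun 4} (h0 : V 0 = 0)
    (h1 : V 1 = 0) :
    fieldDerivation V P.drift₂ = 2 * constFun P.r₁ * sinDiff
      * (constFun P.r₁ * (constFun P.m₁ + constFun P.m₂) * coordFun 2 * V 2
        + constFun P.r₂ * constFun P.m₂ * cosDiff * coordFun 3 * V 3) := by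
  simp only [drift₂, pow_two, Derivation.leibniz, map_add, map_sub, map_neg,
    Derivation.map_algebraMap, smul_eq_mul, fieldDerivation_sinDiff, fieldDerivation_cosDiff,
    fieldDerivation_sinFun, fieldDerivation_coordFun, h0, h1]
  ring

theorem comp₃_zero : P.comp₃ 0 = -(constFun P.m₂ * P.ctrl₁ * P.deltaFun) := by
  simp [comp₃, fieldBracket, comp₁, comp₂, fieldDerivation_deltaFun, fieldDerivation_coordFun]
  ring

theorem comp₃_one : P.comp₃ 1 = -(constFun P.m₂ * P.ctrl₂ * P.deltaFun) := by
  simp [comp₃, fieldBracket, comp₁, comp₂, fieldDerivation_deltaFun, fieldDerivation_coordFun]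
  ring

theorem comp₃_two : P.comp₃ 2 = constFun P.m₂ * (2 * constFun P.m₂ * constFun P.r₂ * sinDiff
      * (constFun P.r₁ * cosDiff * coordFun 2 * P.ctrl₁ + constFun P.r₂ * coordFun 3 * P.ctrl₂)
    - constFun P.r₂ * constFun P.r₁ * constFun P.m₂ * sinDiff
      * ((coordFun 2 - coordFun 3) * P.deltaFun)) := by
  change fieldDerivation P.comp₁ (constFun P.m₂ * P.ctrl₁) - fieldDerivation P.comp₂ P.drift₁ = _
  rw [fieldDerivation_drift₁_of_vertical rfl rfl, Derivation.leibniz, fieldDerivation_ctrl₁,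
    Derivation.map_algebraMap]
  simp [comp₁, comp₂]
  ring

theorem comp₃_three : P.comp₃ 3 = constFun P.m₂ * (-(2 * constFun P.r₁ * sinDiff
      * (constFun P.r₁ * (constFun P.m₁ + constFun P.m₂) * coordFun 2 * P.ctrl₁
        + constFun P.r₂ * constFun P.m₂ * cosDiff * coordFun 3 * P.ctrl₂))
    - constFun P.r₂ * constFun P.r₁ * constFun P.m₁ * sinDiff
      * ((coordFun 2 - coordFun 3) * P.deltaFun)) := by
  change fieldDerivation P.comp₁ (constFun P.m₂ * P.ctrl₂) - fieldDerivation P.comp₂ P.drift₂ = _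
  rw [fieldDerivation_drift₂_of_vertical rfl rfl, Derivation.leibniz, fieldDerivation_ctrl₂,
    Derivation.map_algebraMap]
  simp [comp₁, comp₂]
  ring

theorem comp₄_zero : P.comp₄ 0 = 0 := by
  change fieldDerivation P.comp₂ (P.comp₃ 0) - fieldDerivation P.comp₃ 0 = 0
  simp [comp₃_zero, comp₂, fieldDerivation_deltaFun, fieldDerivation_ctrl₁]

theorem comp₄_one : P.comp₄ 1 = 0 := by
  change fieldDerivation P.comp₂ (P.comp₃ 1) - fieldDerivation P.comp₃ 0 = 0
  simp [comp₃_one, comp₂, fieldDerivation_deltaFun, fieldDerivation_ctrl₂]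

theorem comp₄_two : P.comp₄ 2 = constFun P.m₂ ^ 2 * (2 * constFun P.m₂ * constFun P.r₂ * sinDiff
      * (constFun P.r₁ * cosDiff * P.ctrl₁ ^ 2 + constFun P.r₂ * P.ctrl₂ ^ 2)
    - 2 * constFun P.r₂ * constFun P.r₁ * constFun P.m₂ * sinDiff
      * ((P.ctrl₁ - P.ctrl₂) * P.deltaFun)) := by
  change fieldDerivation P.comp₂ (P.comp₃ 2)
    - fieldDerivation P.comp₃ (constFun P.m₂ * P.ctrl₁) = _
  have h2 : fieldDerivation P.comp₂ 2 = 0 := (fieldDerivation P.comp₂).map_natCast 2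
  simp only [comp₃_two, h2, Derivation.leibniz, map_sub, map_add, Derivation.map_algebraMap,
    smul_eq_mul, fieldDerivation_sinDiff, fieldDerivation_cosDiff,
    fieldDerivation_ctrl₁,
    fieldDerivation_ctrl₂, fieldDerivation_deltaFun, fieldDerivation_coordFun, comp₃_zero,
    comp₃_one]
  simp [comp₂]
  ring

theorem comp₄_three : P.comp₄ 3 = constFun P.m₂ ^ 2 * (-(2 * constFun P.r₁ * sinDiff
      * (constFun P.r₁ * (constFun P.m₁ + constFun P.m₂) * P.ctrl₁ ^ 2
        + constFun P.r₂ * constFun P.m₂ * cosDiff * P.ctrl₂ ^ 2))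
    - 2 * constFun P.r₂ * constFun P.r₁ * constFun P.m₁ * sinDiff
      * ((P.ctrl₁ - P.ctrl₂) * P.deltaFun)) := by
  change fieldDerivation P.comp₂ (P.comp₃ 3)
    - fieldDerivation P.comp₃ (constFun P.m₂ * P.ctrl₂) = _
  have h2 : fieldDerivation P.comp₂ 2 = 0 := (fieldDerivation P.comp₂).map_natCast 2
  simp only [comp₃_three, h2, Derivation.leibniz, map_sub, map_neg, map_add,
    Derivation.map_algebraMap, smul_eq_mul, fieldDerivation_sinDiff, fieldDerivation_cosDiff,
    fieldDerivation_ctrl₁,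
    fieldDerivation_ctrl₂, fieldDerivation_deltaFun, fieldDerivation_coordFun, comp₃_zero,
    comp₃_one]
  simp [comp₂]
  ring

theorem sinDiff_sq : sinDiff ^ 2 = 1 - cosDiff ^ 2 :=
  eq_sub_of_add_eq (sinFun_sq_add_cosFun_sq _)

variable (P) in
/-- The determinant of the vertical fields `X₂` and `X₄`. -/
noncomputable def vertDet : smoothFun 4 :=
  P.comp₂ 2 * P.comp₄ 3 - P.comp₂ 3 * P.comp₄ 2

/-- The determinant factors completely: `X₂` and `X₄` are dependent exactly where
`sin (θ₁ - θ₂)` or a component of the control field vanishes. -/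
theorem vertDet_eq : P.vertDet = constFun (2 * P.m₂ ^ 3 * (P.m₁ + P.m₂) * P.r₁ ^ 2 * P.r₂ ^ 2)
    * (sinDiff * P.massFun * P.ctrl₁ * P.ctrl₂) := by
  have hS := sinDiff_sq
  rw [vertDet, comp₄_two, comp₄_three]
  simp only [comp₂, Matrix.cons_val, deltaFun, massFun, ctrl₁, ctrl₂, constFun, map_mul, map_add,
    map_pow, map_ofNat]
  rw [hS]
  ring

/-- Triangular elimination with the vertical fields `X₂`, `X₄` and the fields `[X₁, X₂]`,
`[X₁, X₄]`, whose horizontal parts are `-Δ` times `X₂` and `X₄`. -/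
theorem vertDet_sq_mul_deltaFun_mem (hpos : P.Positive) :
    P.vertDet ^ 2 * P.deltaFun ∈ bracketIdeal P.family := by
  have m1 : toField P.comp₁ ∈ P.family := by simp [family, X₁_eq hpos]
  have m2 : P.comp₂ ∈ bracketModule P.family :=
    Submodule.subset_span (.mem _ (by simp [family, X₂_eq hpos]))
  have m3 : P.comp₃ ∈ bracketModule P.family :=
    Submodule.subset_span (.mem _ (by simp [family, X₃_eq hpos]))
  have m4 : P.comp₄ ∈ bracketModule P.family :=
    Submodule.subset_span (.mem _ (by simp [family, X₄_eq hpos]))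
  have m5 := fieldBracket_mem_bracketModule m1 m4
  have h50 : fieldBracket P.comp₁ P.comp₄ 0 = -(P.comp₄ 2 * P.deltaFun) := by
    change fieldDerivation P.comp₁ (P.comp₄ 0)
      - fieldDerivation P.comp₄ (coordFun 2 * P.deltaFun) = _
    simp [comp₄_zero, comp₄_one, fieldDerivation_deltaFun, fieldDerivation_coordFun]
    ring
  have h51 : fieldBracket P.comp₁ P.comp₄ 1 = -(P.comp₄ 3 * P.deltaFun) := by
    change fieldDerivation P.comp₁ (P.comp₄ 1)
      - fieldDerivation P.comp₄ (coordFun 3 * P.deltaFun) = _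
    simp [comp₄_zero, comp₄_one, fieldDerivation_deltaFun, fieldDerivation_coordFun]
    ring
  have h30 : P.comp₃ 0 = -(P.comp₂ 2 * P.deltaFun) := comp₃_zero
  have h31 : P.comp₃ 1 = -(P.comp₂ 3 * P.deltaFun) := comp₃_one
  have h20 : P.comp₂ 0 = 0 := rfl
  have h21 : P.comp₂ 1 = 0 := rfl
  have h40 : P.comp₄ 0 = 0 := comp₄_zero
  have h41 : P.comp₄ 1 = 0 := comp₄_one
  generalize fieldBracket P.comp₁ P.comp₄ = Y at *
  intro W
  -- Cramer's rule: first the horizontal components, then the vertical remainder `(R₂, R₃)`.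
  set A := -(P.vertDet * (W 0 * P.comp₄ 3 - W 1 * P.comp₄ 2))
  set B := -(P.vertDet * (W 1 * P.comp₂ 2 - W 0 * P.comp₂ 3))
  set R₂ := P.vertDet * P.deltaFun * W 2
    + (W 0 * P.comp₄ 3 - W 1 * P.comp₄ 2) * P.comp₃ 2
    + (W 1 * P.comp₂ 2 - W 0 * P.comp₂ 3) * Y 2 with hR₂
  set R₃ := P.vertDet * P.deltaFun * W 3
    + (W 0 * P.comp₄ 3 - W 1 * P.comp₄ 2) * P.comp₃ 3
    + (W 1 * P.comp₂ 2 - W 0 * P.comp₂ 3) * Y 3 with hR₃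
  have key : (P.vertDet ^ 2 * P.deltaFun) • W
      = A • P.comp₃ + B • Y + (R₂ * P.comp₄ 3 - R₃ * P.comp₄ 2) • P.comp₂
        + (R₃ * P.comp₂ 2 - R₂ * P.comp₂ 3) • P.comp₄ := by
    have hd : P.vertDet = P.comp₂ 2 * P.comp₄ 3 - P.comp₂ 3 * P.comp₄ 2 := rfl
    funext i
    fin_cases i
    · change _ * W 0 = A * P.comp₃ 0 + B * Y 0 + _ * P.comp₂ 0 + _ * P.comp₄ 0
      rw [h30, h50, h20, h40, hd]
      simp only [A, B, hd]
      ring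
    · change _ * W 1 = A * P.comp₃ 1 + B * Y 1 + _ * P.comp₂ 1 + _ * P.comp₄ 1
      rw [h31, h51, h21, h41, hd]
      simp only [A, B, hd]
      ring
    · change _ * W 2 = A * P.comp₃ 2 + B * Y 2 + _ * P.comp₂ 2 + _ * P.comp₄ 2
      simp only [A, B, hR₂, hR₃, hd]
      ring
    · change _ * W 3 = A * P.comp₃ 3 + B * Y 3 + _ * P.comp₂ 3 + _ * P.comp₄ 3
      simp only [A, B, hR₂, hR₃, hd]
      ring
  rw [key]
  exact add_mem (add_mem (add_mem (Submodule.smul_mem _ _ m3) (Submodule.smul_mem _ _ m5))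
    (Submodule.smul_mem _ _ m2)) (Submodule.smul_mem _ _ m4)

/-- The control field vanishes nowhere: `ctrl₁ = ctrl₂ = 0` would force
`cos² (θ₁ - θ₂) = (m₁ + m₂) / m₂ > 1`. -/
theorem not_ctrl_eq_zero (hpos : P.Positive) (p : PIDPState)
    (h1 : evalAt p P.ctrl₁ = 0) (h2 : evalAt p P.ctrl₂ = 0) : False := by
  obtain ⟨ha, hb, hr, hs, -⟩ := hpos
  set c := Real.cos (p 0 - p 1) with hc
  have e1 : P.r₂ * (P.r₁ * P.m₂ * c - P.r₂ * P.m₁) = 0 := h1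
  have e2 : P.r₁ * (P.r₂ * P.m₁ * c - P.r₁ * (P.m₁ + P.m₂)) = 0 := h2
  have e1' := (mul_eq_zero.1 e1).resolve_left hs.ne'
  have e2' := (mul_eq_zero.1 e2).resolve_left hr.ne'
  have e3 : P.r₁ * (P.m₂ * c ^ 2 - (P.m₁ + P.m₂)) = 0 := by linear_combination c * e1' + e2'
  have e4 := (mul_eq_zero.1 e3).resolve_left hr.ne'
  have hc1 : c ^ 2 ≤ 1 := Real.cos_sq_le_one _
  nlinarith

/-- A prime differential ideal `Q` as in `exists_isPrime_of_lieSpanAt_ne_top` is pushed to a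
contradiction: it has to contain `sin (θ₁ - θ₂)`, hence `ω₁ - ω₂`, `sin θ₁` and `cos θ₁`. -/
theorem lieSpanAt_family_eq_top (hpos : P.Positive) (p : PIDPState) :
    lieSpanAt P.family p = ⊤ := by
  by_contra hne
  obtain ⟨Q, hQ, hQp, hFQ, hD⟩ := exists_isPrime_of_lieSpanAt_ne_top hne
  have hev : ∀ φ ∈ Q, evalAt p φ = 0 := fun φ hφ => RingHom.mem_ker.1 (hQp hφ)
  have hD1 := hD P.comp₁ (by simp [family, X₁_eq hpos])
  have hD3 := hD P.comp₃ (by simp [family, X₃_eq hpos])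
  have hctrl : ¬ (P.ctrl₁ ∈ Q ∧ P.ctrl₂ ∈ Q) := fun h =>
    not_ctrl_eq_zero hpos p (hev _ h.1) (hev _ h.2)
  obtain ⟨ha, hb, hr, hs, hg⟩ := id hpos
  have hconst : ∀ k : ℝ, k ≠ 0 → constFun k ∉ Q := fun k hk h => hk (hev _ h)
  have hmass : P.massFun ∉ Q := fun h => by
    have e : P.m₁ + P.m₂ * Real.sin (p 0 - p 1) ^ 2 = 0 := hev _ h
    have : 0 < P.m₁ + P.m₂ * Real.sin (p 0 - p 1) ^ 2 := by positivity
    exact this.ne' e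
  have hdelta : P.deltaFun ∉ Q := fun h =>
    (hpos.Delta_pos p).ne' (hev _ h)
  -- The component of `X₃` transversal to the level sets of `θ₁ - θ₂`.
  have hdiff : P.comp₃ 0 - P.comp₃ 1
      = -(constFun P.m₂ * P.deltaFun * (P.ctrl₁ - P.ctrl₂)) := by
    rw [comp₃_zero, comp₃_one]
    ring
  have hdiff_mem : P.comp₃ 0 - P.comp₃ 1 ∈ Q → P.ctrl₁ - P.ctrl₂ ∈ Q := fun h => by
    rw [hdiff, neg_mem_iff] at h
    exact (hQ.mem_or_mem h).resolve_left fun h' =>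
      (hQ.mem_or_mem h').elim (hconst _ hb.ne') hdelta
  have hsin : sinDiff ∈ Q → cosDiff ∉ Q := fun h h' => by
    have e1 : Real.sin (p 0 - p 1) = 0 := hev _ h
    have e2 : Real.cos (p 0 - p 1) = 0 := hev _ h'
    have := Real.sin_sq_add_cos_sq (p 0 - p 1)
    simp [e1, e2] at this
  have hsin_ctrl : sinDiff ∈ Q → P.ctrl₁ - P.ctrl₂ ∈ Q := fun h => by
    have h3 := hD3 _ h
    rw [fieldDerivation_sinDiff] at h3
    exact hdiff_mem ((hQ.mem_or_mem h3).resolve_left (hsin h))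
  -- The derivative of a control component along `X₃` is `sin δ * (ctrl₁ - ctrl₂)` times a
  -- function outside `Q`, where `δ = θ₁ - θ₂`. If `sin δ ∈ Q`, its own derivative along `X₃`
  -- still gives `ctrl₁ - ctrl₂ ∈ Q`, so both control components lie in `Q`.
  have hctrl₁ : P.ctrl₁ ∉ Q := fun h => by
    have h3 := hD3 _ h
    rw [fieldDerivation_ctrl₁, neg_mem_iff] at h3
    have h4 : P.ctrl₁ - P.ctrl₂ ∈ Q := by
      rcases hQ.mem_or_mem h3 with h3 | h3
      · refine hsin_ctrl ((hQ.mem_or_mem h3).resolve_left ?_)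
        simpa only [constFun, ← map_mul] using hconst _ (by positivity)
      · exact hdiff_mem h3
    exact hctrl ⟨h, by simpa using sub_mem h h4⟩
  have hctrl₂ : P.ctrl₂ ∉ Q := fun h => by
    have h3 := hD3 _ h
    rw [fieldDerivation_ctrl₂, neg_mem_iff] at h3
    have h4 : P.ctrl₁ - P.ctrl₂ ∈ Q := by
      rcases hQ.mem_or_mem h3 with h3 | h3
      · refine hsin_ctrl ((hQ.mem_or_mem h3).resolve_left ?_)
        simpa only [constFun, ← map_mul] using hconst _ (by positivity)
      · exact hdiff_mem h3
    exact hctrl ⟨by simpa using add_mem h4 h, h⟩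
  have hS : sinDiff ∈ Q := by
    have h1 := (hQ.mem_or_mem (hFQ (vertDet_sq_mul_deltaFun_mem hpos))).resolve_right hdelta
    have h2 := hQ.mem_of_pow_mem _ h1
    rw [vertDet_eq] at h2
    have h3 := (hQ.mem_or_mem h2).resolve_left (hconst _ (by positivity))
    have h4 := (hQ.mem_or_mem h3).resolve_right hctrl₂
    have h5 := (hQ.mem_or_mem h4).resolve_right hctrl₁
    exact (hQ.mem_or_mem h5).resolve_right hmass
  have hω : coordFun 2 - coordFun 3 ∈ Q := by
    have h1 := hD1 _ hS
    rw [fieldDerivation_sinDiff] at h1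
    have h2 := (hQ.mem_or_mem h1).resolve_left (hsin hS)
    have h3 : P.comp₁ 0 - P.comp₁ 1 = (coordFun 2 - coordFun 3) * P.deltaFun :=
      (sub_mul _ _ _).symm
    rw [h3] at h2
    exact (hQ.mem_or_mem h2).resolve_right hdelta
  have hθ : sinFun (coordFun 0) ∈ Q := by
    have h1 := hD1 _ hω
    rw [map_sub, fieldDerivation_coordFun, fieldDerivation_coordFun] at h1
    change P.drift₁ - P.drift₂ ∈ Q at h1
    -- Substituting `θ₂ = θ₁ - (θ₁ - θ₂)`, the difference of the accelerations is
    -- `g r₂ m₁ sin θ₁` up to a multiple of `sin (θ₁ - θ₂)`.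
    have hsub : sinFun (coordFun 1)
        = sinFun (coordFun 0) * cosDiff - cosFun (coordFun 0) * sinDiff :=
      Subtype.ext <| funext fun z => by
        change Real.sin (z 1) = Real.sin (z 0) * Real.cos (z 0 - z 1)
          - Real.cos (z 0) * Real.sin (z 0 - z 1)
        rw [← Real.sin_sub]
        congr 1
        ring
    have h2 : ∃ ψ, P.drift₁ - P.drift₂
        = constFun (P.g * P.r₂ * P.m₁) * sinFun (coordFun 0) + ψ * sinDiff := by
      refine ⟨constFun P.g * constFun P.r₂ * constFun P.m₂
          * (sinDiff * sinFun (coordFun 0) + cosFun (coordFun 0) * cosDiff)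
        + constFun P.g * constFun P.r₁ * (constFun P.m₁ + constFun P.m₂) * cosFun (coordFun 0)
        + (-constFun P.m₂ * constFun P.r₂ * (constFun P.r₁ * cosDiff * coordFun 2 ^ 2
          + constFun P.r₂ * coordFun 3 ^ 2))
        - constFun P.r₁ * (constFun P.r₁ * (constFun P.m₁ + constFun P.m₂) * coordFun 2 ^ 2
          + constFun P.r₂ * constFun P.m₂ * cosDiff * coordFun 3 ^ 2), ?_⟩
      rw [drift₁, drift₂, hsub]
      simp only [constFun, map_mul]
      linear_combination (algebraMap ℝ (smoothFun 4) P.g * algebraMap ℝ (smoothFun 4) P.r₂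
        * algebraMap ℝ (smoothFun 4) P.m₂ * sinFun (coordFun 0)) * (-sinDiff_sq)
    obtain ⟨ψ, hψ⟩ := h2
    rw [hψ, add_mem_cancel_right (Q.mul_mem_left _ hS)] at h1
    exact (hQ.mem_or_mem h1).resolve_left (hconst _ (by positivity))
  have hcos : cosFun (coordFun 0) ∈ Q := by
    have h1 := hD3 _ hθ
    rw [fieldDerivation_sinFun, fieldDerivation_coordFun, comp₃_zero] at h1
    refine (hQ.mem_or_mem h1).resolve_right fun h2 => ?_
    rw [neg_mem_iff] at h2
    have h3 := (hQ.mem_or_mem h2).resolve_right hdelta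
    exact (hQ.mem_or_mem h3).elim (hconst _ hb.ne') hctrl₁
  have e1 : Real.sin (p 0) = 0 := hev _ hθ
  have e2 : Real.cos (p 0) = 0 := hev _ hcos
  have := Real.sin_sq_add_cos_sq (p 0)
  simp [e1, e2] at this

end PIDPParams

theorem mainTheorem2 (P : PIDPParams) (hpos : P.Positive) (hnd : P.Nondegenerate)
    (C : Set ℝ) (hC : IsOpen C) :
    IsBracketGeneratingOn P.family (P.energyRegion C) :=
  fun p _ => P.lieSpanAt_family_eq_top hpos p
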